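/- \textbf{Types and functionals.} The finite types are $0$ and $(\sigma_1,\dots,\sigma_n\to 0)$ for types $\sigma_1,\dots,\sigma_n$, $n\ge 1$; we identify $(\sigma_1,\dots,\sigma_n\to 0)$ with $\sigma_1\to(\sigma_2,\dots,\sigma_n\to 0)$. The rank is $\mathbf r(0)=0$, $\mathbf r(\sigma_1,\dots,\sigma_n\to0)=\max_i(\mathbf r(\sigma_i)+1)$, and $\mathbf{Ty}(k)$ is the set of types of rank $\le k$. Put $\mathbf F(0)=\mathbb N$, $\mathbf P(0)=\mathbb N_\bot=\mathbb N\cup\{\bot\}$, and for $\sigma=(\sigma_1,\dots,\sigma_n\to0)$ let $\mathbf F(\sigma)$ (resp. $\mathbf P(\sigma)$) be the set of all functions from $\mathbf F(\sigma_1)\times\dots\times\mathbf F(\sigma_n)$ to $\mathbb N$ (resp. to $\mathbb N_\bot$), so that $\mathbf F(\sigma)\subseteq\mathbf P(\sigma)$. For $\phi,\psi\in\mathbf P(\sigma)$, $\phi\preceq\psi$ means that $\psi$ extends $\phi$: wherever $\phi$ is defined (not $\bot$), $\psi$ is defined with the same value. \textbf{Terms.} Typed terms are built from: the constants $\hat 0$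 of type $0$, $\mathsf{suc},\mathsf{pred}$ of type $0\to0$ and $\mathsf{case}$ of type $0,0,0\to0$; variables $x_i^\sigma$ ($i\in\mathbb N$, $\sigma\in\mathbf{Ty}(3)$); a secondary constant $\hat\phi$ for each $\phi\in\mathbf P(\sigma)$, $\sigma\in\mathbf{Ty}(3)$; application $(ts)$ of type $\tau$ for $t$ of type $\sigma\to\tau$ and $s$ of type $\sigma$; abstraction $\lambda x_i^\sigma t$ of type $\sigma\to\tau$ for $t$ of type $\tau$, if $\mathbf r(\sigma\to\tau)\le3$; and $\mu x_i^\sigma t$ of type $\sigma$ for $t$ of type $\sigma\in\mathbf{Ty}(3)$. \textbf{Interpretation.} Given an assignment of elements of $\mathbf P(\sigma)$ to the variables $x_i^\sigma$, a term $t$ of type $\tau$ is interpreted as $[[t]]\in\mathbf P(\tau)$: variables by the assignment, $\hat\phi$ by $\phi$, $\hat0$ by $0$, $\mathsf{suc}$ and $\mathsf{pred}$ by successor and predecessor (with $\mathsf{pred}(0)=0$), $\mathsf{case}(0,x,y)=x$ and $\mathsf{case}(z+1,x,y)=y$; $[[ts]]=[[t]]([[s]])$ if $[[s]]$ is total, and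 $[[ts]]$ is everywhere undefined otherwise, except that $[[\mathsf{case}\,t_1t_2t_3]]$ only requires $[[t_1]]$ and the selected one of $[[t_2]],[[t_3]]$ to be defined; $[[\lambda x_i^\sigma t]]$ sends $f\in\mathbf F(\sigma)$ to the value of $[[t]]$ with $f$ assigned to $x_i^\sigma$; $[[\mu x_i^\sigma t]]$ is the $\preceq$-least fixed point of the monotone map sending $\psi\in\mathbf P(\sigma)$ to the value of $[[t]]$ with $\psi$ assigned to $x_i^\sigma$. \textbf{Computability.} Let $\Phi\in\mathbf P(\tau)$ and $\Phi_i\in\mathbf P(\sigma_i)$ ($i=1,\dots,n$), with all types in $\mathbf{Ty}(3)$. Then $\Phi$ is \emph{computable in} $\Phi_1,\dots,\Phi_n$ if there is a term $s$ of type $\tau$ without secondary constants, with free variables among distinct variables $x_1,\dots,x_n$ of types $\sigma_1,\dots,\sigma_n$, such that $\Phi\preceq[[s(x_1,\dots,x_n/\hat\Phi_1,\dots,\hat\Phi_n)]]$. \textbf{Countably based functionals.} Let $\sigma=(\tau_1,\dots,\tau_m\to0)\in\mathbf{Ty}(3)$ with $\tau_i=(\delta_{i,1},\dots,\delta_{i,m_i}\to0)$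 ($m,m_i\ge0$, where length $0$ means type $0$, and an empty product is a one-point set). A functional $\Psi\in\mathbf P(\sigma)$ is \emph{countably based} if, whenever $\Psi(F_1,\dots,F_m)\in\mathbb N$, there are countable sets $X_i\subseteq\mathbf F(\delta_{i,1})\times\dots\times\mathbf F(\delta_{i,m_i})$ ($i=1,\dots,m$) such that $\Psi(F_1,\dots,F_m)=\Psi(G_1,\dots,G_m)$ whenever $\Psi(G_1,\dots,G_m)\in\mathbb N$ and $F_i$, $G_i$ are equal on $X_i$ for each $i$. (Here $F_i,G_i\in\mathbf F(\tau_i)$ are total.) \textbf{Theorem.} Let $\Phi,\Phi_1,\dots,\Phi_n$ be partial functionals, i.e. elements of $\mathbf P(\tau),\mathbf P(\sigma_1),\dots,\mathbf P(\sigma_n)$, of types in $\mathbf{Ty}(3)$. If $\Phi$ is computable in $\Phi_1,\dots,\Phi_n$ and each $\Phi_i$ is countably based, then $\Phi$ is countably based. -/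

import Mathlib

namespace PartialFun

/-- Finite types, in curried form: `arr σ₁ (arr σ₂ (… (arr σₙ nat)))` is `(σ₁,…,σₙ → 0)`. -/
inductive Ty : Type
  | nat : Ty
  | arr : Ty → Ty → Ty
  deriving DecidableEq

namespace Ty

/-- The rank: `r(0) = 0` and `r(σ₁,…,σₙ → 0) = max (r(σᵢ) + 1)`. -/
def rank : Ty → ℕ
  | nat => 0
  | arr σ τ => max (rank σ + 1) (rank τ)

end Ty

/-- `F(σ)`: the total functionals, i.e. all functions `F(σ₁) × ⋯ × F(σₙ) → ℕ` (curried). -/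
def Tot : Ty → Type
  | .nat => ℕ
  | .arr σ τ => Tot σ → Tot τ

/-- `P(σ)`: the partial functionals, i.e. all functions `F(σ₁) × ⋯ × F(σₙ) → ℕ ∪ {⊥}` (curried),
where `none` stands for `⊥`. The arguments are always total. -/
def Par : Ty → Type
  | .nat => Option ℕ
  | .arr σ τ => Tot σ → Par τ

/-- The product `F(σ₁) × ⋯ × F(σₙ)` for `σ = (σ₁,…,σₙ → 0)` (a one-point set for `σ = 0`). -/
def Args : Ty → Type
  | .nat => Unit
  | .arr σ τ => Tot σ × Args τ

/-- The value of a total functional at a full tuple of arguments. -/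
def Tot.eval : {σ : Ty} → Tot σ → Args σ → ℕ
  | .nat, n, _ => n
  | .arr _ _, f, a => Tot.eval (f a.1) a.2

/-- The value in `ℕ ∪ {⊥}` of a partial functional at a full tuple of arguments. -/
def Par.eval : {σ : Ty} → Par σ → Args σ → Option ℕ
  | .nat, n, _ => n
  | .arr _ _, f, a => Par.eval (f a.1) a.2

/-- The inclusion `F(σ) ⊆ P(σ)`. -/
def Tot.toPar : {σ : Ty} → Tot σ → Par σ
  | .nat, n => some n
  | .arr _ _, f => fun x => Tot.toPar (f x)

/-- The everywhere undefined element of `P(σ)`. -/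
def Par.bot : (σ : Ty) → Par σ
  | .nat => none
  | .arr _ τ => fun _ => Par.bot τ

/-- The extension order on `P(σ)`: wherever `φ` is defined, `ψ` is defined with the same value. -/
def Par.Le {σ : Ty} (φ ψ : Par σ) : Prop :=
  ∀ (a : Args σ) (k : ℕ), φ.eval a = some k → ψ.eval a = some k

open Classical in
/-- Application in `P`: everywhere undefined unless the argument is total. -/
noncomputable def Par.app {σ τ : Ty} (φ : Par (.arr σ τ)) (ψ : Par σ) : Par τ :=
  if h : ∃ f : Tot σ, f.toPar = ψ then φ h.choose else Par.bot τ

/-- `ψ` is the least fixed point of `f`. -/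
def Par.IsLeastFixedPoint {σ : Ty} (f : Par σ → Par σ) (ψ : Par σ) : Prop :=
  f ψ = ψ ∧ ∀ χ, f χ = χ → ψ.Le χ

open Classical in
/-- The least fixed point of `f`; for monotone `f` it exists, see `Par.lfp_spec`. -/
noncomputable def Par.lfp {σ : Ty} (f : Par σ → Par σ) : Par σ :=
  if h : ∃ ψ, Par.IsLeastFixedPoint f ψ then h.choose else Par.bot σ

theorem Par.eval_bot : {σ : Ty} → (a : Args σ) → (Par.bot σ).eval a = none
  | .nat, _ => rfl
  | .arr _ _, a => Par.eval_bot a.2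

theorem Par.ext_eval : {σ : Ty} → {φ ψ : Par σ} → (∀ a, φ.eval a = ψ.eval a) → φ = ψ
  | .nat, _, _, h => h ()
  | .arr _ _, _, _, h => funext fun x => Par.ext_eval fun a => h (x, a)

theorem Tot.eval_toPar : {σ : Ty} → (f : Tot σ) → (a : Args σ) → f.toPar.eval a = some (f.eval a)
  | .nat, _, _ => rfl
  | .arr _ _, f, a => Tot.eval_toPar (f a.1) a.2

theorem Tot.toPar_injective : {σ : Ty} → Function.Injective (Tot.toPar (σ := σ))
  | .nat, _, _, h => Option.some.inj h
  | .arr _ _, _, _, h => funext fun x => Tot.toPar_injective (congrFun h x)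

theorem Par.Le.refl {σ : Ty} (φ : Par σ) : φ.Le φ := fun _ _ h => h

theorem Par.Le.of_eq {σ : Ty} {φ ψ : Par σ} (h : φ = ψ) : φ.Le ψ := h ▸ Par.Le.refl φ

theorem Par.Le.trans {σ : Ty} {φ ψ χ : Par σ} (h : φ.Le ψ) (h' : ψ.Le χ) : φ.Le χ :=
  fun a k e => h' a k (h a k e)

theorem Par.Le.antisymm {σ : Ty} {φ ψ : Par σ} (h : φ.Le ψ) (h' : ψ.Le φ) : φ = ψ :=
  Par.ext_eval fun a => Option.ext fun k => ⟨h a k, h' a k⟩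

theorem Par.bot_le {σ : Ty} (φ : Par σ) : (Par.bot σ).Le φ := fun a k h => by
  rw [Par.eval_bot] at h; cases h

theorem Par.eq_toPar_of_le {σ : Ty} {f : Tot σ} {ψ : Par σ} (h : f.toPar.Le ψ) : ψ = f.toPar :=
  Par.ext_eval fun a => by rw [h a _ (f.eval_toPar a), f.eval_toPar]

theorem Par.app_toPar {σ τ : Ty} (φ : Par (.arr σ τ)) (f : Tot σ) : φ.app f.toPar = φ f := by
  have h : ∃ g : Tot σ, g.toPar = f.toPar := ⟨f, rfl⟩
  rw [Par.app, dif_pos h, Tot.toPar_injective h.choose_spec]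

theorem Par.app_eq_bot {σ τ : Ty} (φ : Par (.arr σ τ)) {ψ : Par σ}
    (h : ¬ ∃ f : Tot σ, f.toPar = ψ) : φ.app ψ = Par.bot τ := dif_neg h

theorem Par.app_mono {σ τ : Ty} {φ φ' : Par (.arr σ τ)} {ψ ψ' : Par σ} (h : φ.Le φ')
    (h' : ψ.Le ψ') : (φ.app ψ).Le (φ'.app ψ') := by
  by_cases ht : ∃ f : Tot σ, f.toPar = ψ
  · obtain ⟨f, rfl⟩ := ht
    rw [Par.eq_toPar_of_le h', Par.app_toPar, Par.app_toPar]
    exact fun a k e => h (f, a) k e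
  · rw [Par.app_eq_bot φ ht]
    exact Par.bot_le _

/-- The partial functional with a given evaluation. -/
def Par.ofEval : {σ : Ty} → (Args σ → Option ℕ) → Par σ
  | .nat, e => e ()
  | .arr _ _, e => fun x => Par.ofEval fun a => e (x, a)

theorem Par.eval_ofEval : {σ : Ty} → (e : Args σ → Option ℕ) → (a : Args σ) →
    (Par.ofEval e).eval a = e a
  | .nat, _, _ => rfl
  | .arr _ _, e, a => Par.eval_ofEval (fun b => e (a.1, b)) a.2

/-- Every chain of partial functionals has a supremum. -/
theorem Par.exists_chain_sup {σ : Ty} (c : Set (Par σ))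
    (hc : ∀ φ ∈ c, ∀ ψ ∈ c, φ.Le ψ ∨ ψ.Le φ) :
    ∃ u : Par σ, (∀ φ ∈ c, φ.Le u) ∧ ∀ a k, u.eval a = some k → ∃ φ ∈ c, φ.eval a = some k := by
  classical
  refine ⟨Par.ofEval fun a =>
    if h : ∃ k, ∃ φ ∈ c, φ.eval a = some k then some h.choose else none, ?_, ?_⟩
  · intro φ hφ a k hk
    have h : ∃ k, ∃ φ ∈ c, φ.eval a = some k := ⟨k, φ, hφ, hk⟩
    rw [Par.eval_ofEval, dif_pos h]
    obtain ⟨ψ, hψ, e⟩ := h.choose_spec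
    rcases hc φ hφ ψ hψ with l | l
    · rw [← e, l a k hk]
    · rw [← hk, l a _ e]
  · intro a k hk
    rw [Par.eval_ofEval] at hk
    split_ifs at hk with h
    obtain ⟨ψ, hψ, e⟩ := h.choose_spec
    exact ⟨ψ, hψ, e.trans hk⟩

/-- A monotone map on partial functionals has a fixed point below all pre-fixed points. -/
theorem Par.exists_lfp {σ : Ty} (f : Par σ → Par σ) (hf : ∀ φ ψ, φ.Le ψ → (f φ).Le (f ψ)) :
    ∃ ψ, f ψ = ψ ∧ ∀ χ, (f χ).Le χ → ψ.Le χ := by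
  let A : Set (Par σ) := {ψ | ψ.Le (f ψ) ∧ ∀ χ, (f χ).Le χ → ψ.Le χ}
  obtain ⟨m, hm⟩ := exists_maximal_of_chains_bounded (α := A) (r := fun φ ψ => φ.1.Le ψ.1)
    (fun c hc => by
      have tot : ∀ φ ∈ Subtype.val '' c, ∀ ψ ∈ Subtype.val '' c, φ.Le ψ ∨ ψ.Le φ := by
        rintro _ ⟨φ, hφ, rfl⟩ _ ⟨ψ, hψ, rfl⟩
        by_cases e : φ = ψ
        · exact Or.inl (e ▸ Par.Le.refl _)
        · exact hc hφ hψ e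
      obtain ⟨u, hu, hu'⟩ := Par.exists_chain_sup (Subtype.val '' c) tot
      refine ⟨⟨u, fun a k hk => ?_, fun χ hχ a k hk => ?_⟩, fun φ hφ => hu _ ⟨φ, hφ, rfl⟩⟩
      · obtain ⟨φ, hφ, e⟩ := hu' a k hk
        have l := hf _ _ (hu φ hφ)
        obtain ⟨φ, _, rfl⟩ := hφ
        exact l a k (φ.2.1 a k e)
      · obtain ⟨_, ⟨φ, _, rfl⟩, e⟩ := hu' a k hk
        exact φ.2.2 χ hχ a k e)
    (fun h h' => h.trans h')
  have hfm : f m.1 ∈ A := ⟨hf _ _ m.2.1, fun χ hχ => (hf _ _ (m.2.2 χ hχ)).trans hχ⟩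
  exact ⟨m.1, (hm ⟨f m.1, hfm⟩ m.2.1).antisymm m.2.1, m.2.2⟩

/-- For monotone `f`, the functional `Par.lfp f` is the least fixed point of `f`. -/
theorem Par.lfp_spec {σ : Ty} (f : Par σ → Par σ) (hf : ∀ φ ψ, φ.Le ψ → (f φ).Le (f ψ)) :
    Par.IsLeastFixedPoint f (Par.lfp f) := by
  obtain ⟨ψ, hψ, hle⟩ := Par.exists_lfp f hf
  have h : ∃ ψ, Par.IsLeastFixedPoint f ψ := ⟨ψ, hψ, fun χ hχ => hle χ (hχ.symm ▸ Par.Le.refl χ)⟩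
  rw [Par.lfp, dif_pos h]
  exact h.choose_spec

theorem Par.lfp_le {σ : Ty} (f : Par σ → Par σ) (hf : ∀ φ ψ, φ.Le ψ → (f φ).Le (f ψ))
    {χ : Par σ} (hχ : (f χ).Le χ) : (Par.lfp f).Le χ := by
  obtain ⟨ψ, hψ, hle⟩ := Par.exists_lfp f hf
  exact ((Par.lfp_spec f hf).2 ψ hψ).trans (hle χ hχ)

/-- Terms. For every type of rank at most three there are variables `x_i^σ` (`var i σ`) and a
secondary constant for each element of `P(σ)`. The constant `case` denotes a total object, so that
`app` (which needs total arguments) would make it strict; as `case t₁ t₂ t₃` only evaluates the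
selected branch, the full application of `case` to three terms has its own constructor `caseOf`. -/
inductive Term : Ty → Type
  | zero : Term .nat
  | suc : Term (.arr .nat .nat)
  | pred : Term (.arr .nat .nat)
  | case : Term (.arr .nat (.arr .nat (.arr .nat .nat)))
  | caseOf (t₁ t₂ t₃ : Term .nat) : Term .nat
  | var (i : ℕ) (σ : Ty) (hσ : σ.rank ≤ 3) : Term σ
  | const {σ : Ty} (hσ : σ.rank ≤ 3) (φ : Par σ) : Term σ
  | app {σ τ : Ty} (t : Term (.arr σ τ)) (s : Term σ) : Term τ
  | lam (i : ℕ) (σ : Ty) {τ : Ty} (h : (Ty.arr σ τ).rank ≤ 3) (t : Term τ) : Term (.arr σ τ)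
  | mu (i : ℕ) (σ : Ty) (hσ : σ.rank ≤ 3) (t : Term σ) : Term σ

/-- Assignments of partial objects to all variables `x_i^σ`. -/
abbrev Env : Type := (σ : Ty) → ℕ → Par σ

/-- The assignment `ρ` with the value at `x_i^σ` replaced by `φ`. -/
def Env.set (ρ : Env) (i : ℕ) (σ : Ty) (φ : Par σ) : Env :=
  fun τ j => if h : σ = τ ∧ i = j then h.1 ▸ φ else ρ τ j

/-- The value `case(z, x, y)`: `z` has to be defined, and then only the selected one of `x`, `y`
has to be defined. -/
def caseVal : Option ℕ → Option ℕ → Option ℕ → Option ℕ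
  | none, _, _ => none
  | some 0, x, _ => x
  | some (_ + 1), _, y => y

/-- The interpretation `[[t]]`. -/
noncomputable def Term.interp : {σ : Ty} → Term σ → Env → Par σ
  | _, .zero, _ => some (0 : ℕ)
  | _, .suc, _ => fun n : ℕ => some (n + 1)
  | _, .pred, _ => fun n : ℕ => some (n - 1)
  | _, .case, _ => fun z x y : ℕ => caseVal (some z) (some x) (some y)
  | _, .caseOf t₁ t₂ t₃, ρ => caseVal (t₁.interp ρ) (t₂.interp ρ) (t₃.interp ρ)
  | _, .var i σ _, ρ => ρ σ i
  | _, .const _ φ, _ => φ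
  | _, .app t s, ρ => Par.app (t.interp ρ) (s.interp ρ)
  | _, .lam i σ _ t, ρ => fun f : Tot σ => t.interp (ρ.set i σ f.toPar)
  | _, .mu i σ _ t, ρ => Par.lfp fun ψ : Par σ => t.interp (ρ.set i σ ψ)

theorem caseVal_mono {z z' x x' y y' : Option ℕ} (hz : ∀ k, z = some k → z' = some k)
    (hx : ∀ k, x = some k → x' = some k) (hy : ∀ k, y = some k → y' = some k) (k : ℕ)
    (h : caseVal z x y = some k) : caseVal z' x' y' = some k := by
  match z, h with
  | some 0, h => rw [hz 0 rfl]; exact hx k h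
  | some (m + 1), h => rw [hz (m + 1) rfl]; exact hy k h

theorem Env.set_mono {ρ ρ' : Env} (h : ∀ σ i, (ρ σ i).Le (ρ' σ i)) (i : ℕ) (σ : Ty)
    {φ φ' : Par σ} (hφ : φ.Le φ') : ∀ τ j, (ρ.set i σ φ τ j).Le (ρ'.set i σ φ' τ j) := by
  intro τ j
  unfold Env.set
  split_ifs with e
  · obtain ⟨rfl, rfl⟩ := e
    exact hφ
  · exact h τ j

/-- The interpretation is monotone. -/
theorem Term.interp_mono {σ : Ty} (t : Term σ) : ∀ {ρ ρ' : Env},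
    (∀ σ i, (ρ σ i).Le (ρ' σ i)) → (t.interp ρ).Le (t.interp ρ') := by
  induction t with
  | zero => exact fun _ => Par.Le.refl _
  | suc => exact fun _ => Par.Le.refl _
  | pred => exact fun _ => Par.Le.refl _
  | case => exact fun _ => Par.Le.refl _
  | caseOf t₁ t₂ t₃ h₁ h₂ h₃ =>
    exact fun h _ => caseVal_mono (h₁ h ()) (h₂ h ()) (h₃ h ())
  | var i σ hσ => exact fun h => h σ i
  | const hσ φ => exact fun _ => Par.Le.refl _
  | app t s ht hs => exact fun h => Par.app_mono (ht h) (hs h)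
  | lam i σ hr t ht =>
    exact fun h a => ht (Env.set_mono h i σ (Par.Le.refl _)) a.2
  | mu i σ hσ t ht =>
    intro ρ ρ' h
    have m : ∀ ρ : Env, ∀ φ ψ : Par σ, φ.Le ψ →
        (t.interp (ρ.set i σ φ)).Le (t.interp (ρ.set i σ ψ)) :=
      fun ρ φ ψ l => ht (Env.set_mono (fun _ _ => Par.Le.refl _) i σ l)
    refine Par.lfp_le _ (m ρ) ((ht (Env.set_mono h i σ (Par.Le.refl _))).trans ?_)
    exact Par.Le.of_eq (Par.lfp_spec _ (m ρ')).1

/-- The interpretation of `μ x. t` is the least fixed point. -/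
theorem Term.interp_mu {σ : Ty} (i : ℕ) (hσ : σ.rank ≤ 3) (t : Term σ) (ρ : Env) :
    Par.IsLeastFixedPoint (fun ψ => t.interp (ρ.set i σ ψ)) ((Term.mu i σ hσ t).interp ρ) :=
  Par.lfp_spec _ fun _ _ l => t.interp_mono (Env.set_mono (fun _ _ => Par.Le.refl _) i σ l)

/-- `t` contains no secondary constants. -/
def Term.NoConst : {σ : Ty} → Term σ → Prop
  | _, .zero => True
  | _, .suc => True
  | _, .pred => True
  | _, .case => True
  | _, .caseOf t₁ t₂ t₃ => t₁.NoConst ∧ t₂.NoConst ∧ t₃.NoConst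
  | _, .var _ _ _ => True
  | _, .const _ _ => False
  | _, .app t s => t.NoConst ∧ s.NoConst
  | _, .lam _ _ _ t => t.NoConst
  | _, .mu _ _ _ t => t.NoConst

/-- The set of free variables of a term, `(τ, j)` standing for `x_j^τ`. -/
def Term.freeVars : {σ : Ty} → Term σ → Set (Ty × ℕ)
  | _, .zero => ∅
  | _, .suc => ∅
  | _, .pred => ∅
  | _, .case => ∅
  | _, .caseOf t₁ t₂ t₃ => t₁.freeVars ∪ t₂.freeVars ∪ t₃.freeVars
  | _, .var i σ _ => {(σ, i)}
  | _, .const _ _ => ∅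
  | _, .app t s => t.freeVars ∪ s.freeVars
  | _, .lam i σ _ t => t.freeVars \ {(σ, i)}
  | _, .mu i σ _ t => t.freeVars \ {(σ, i)}

/-- Replacements `x_i^σ ↦ φ` of variables by partial objects. -/
abbrev Repl : Type := (σ : Ty) → ℕ → Option (Par σ)

/-- The replacement `θ`, except that `x_i^σ` is not replaced. -/
def Repl.erase (θ : Repl) (i : ℕ) (σ : Ty) : Repl :=
  fun τ j => if σ = τ ∧ i = j then none else θ τ j

/-- Simultaneous substitution of secondary constants for free variables. -/
def Term.subst : {σ : Ty} → Term σ → Repl → Term σ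
  | _, .zero, _ => .zero
  | _, .suc, _ => .suc
  | _, .pred, _ => .pred
  | _, .case, _ => .case
  | _, .caseOf t₁ t₂ t₃, θ => .caseOf (t₁.subst θ) (t₂.subst θ) (t₃.subst θ)
  | _, .var i σ hσ, θ =>
    match θ σ i with
    | none => .var i σ hσ
    | some φ => .const hσ φ
  | _, .const hσ φ, _ => .const hσ φ
  | _, .app t s, θ => .app (t.subst θ) (s.subst θ)
  | _, .lam i σ h t, θ => .lam i σ h (t.subst (θ.erase i σ))
  | _, .mu i σ hσ t, θ => .mu i σ hσ (t.subst (θ.erase i σ))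

open Classical in
/-- The replacement of the variables `x_{v 0}^{σ 0}, …, x_{v (n-1)}^{σ (n-1)}` by
`φ 0, …, φ (n-1)`. -/
noncomputable def Repl.ofList {n : ℕ} (σ : Fin n → Ty) (v : Fin n → ℕ) (φ : (i : Fin n) → Par (σ i)) :
    Repl :=
  fun τ j => if h : ∃ i, σ i = τ ∧ v i = j then some (h.choose_spec.1 ▸ φ h.choose) else none

/-- `ψ` is computable in `φ 0, …, φ (n-1)`: there is a term `s` without secondary constants, with
free variables among the pairwise different variables `x_{v i}^{σ i}`, such that `ψ` is extended
by the interpretation of the closed term obtained from `s` by putting `φ i` for `x_{v i}^{σ i}`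
(the assignment used for interpreting the closed term is irrelevant). -/
def Computable {τ : Ty} (ψ : Par τ) {n : ℕ} (σ : Fin n → Ty) (φ : (i : Fin n) → Par (σ i)) : Prop :=
  ∃ (s : Term τ) (v : Fin n → ℕ),
    Function.Injective (fun i => (σ i, v i)) ∧
    s.NoConst ∧
    s.freeVars ⊆ Set.range (fun i => (σ i, v i)) ∧
    ψ.Le ((s.subst (Repl.ofList σ v φ)).interp fun τ' _ => Par.bot τ')

/-- For `σ = (τ₁,…,τₙ → 0)` with `τᵢ = (δᵢ₁,…,δᵢₘ → 0)`: families `(X₁,…,Xₙ)` of subsets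
`Xᵢ ⊆ F(δᵢ₁) × ⋯ × F(δᵢₘ)`. -/
def Supp : Ty → Type
  | .nat => Unit
  | .arr τ ρ => Set (Args τ) × Supp ρ

/-- All `Xᵢ` are countable. -/
def Supp.Countable : {σ : Ty} → Supp σ → Prop
  | .nat, _ => True
  | .arr _ _, X => X.1.Countable ∧ Supp.Countable X.2

/-- `Fᵢ` and `Gᵢ` are equal on `Xᵢ`, for all `i`. -/
def Supp.Agree : {σ : Ty} → Supp σ → Args σ → Args σ → Prop
  | .nat, _, _, _ => True
  | .arr _ _, X, F, G => (∀ a ∈ X.1, F.1.eval a = G.1.eval a) ∧ Supp.Agree X.2 F.2 G.2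

/-- Countably based partial functionals: every value `Φ(F₁,…,Fₙ) ∈ ℕ` has countable sets
`X₁,…,Xₙ` such that `Φ(F₁,…,Fₙ) = Φ(G₁,…,Gₙ)` whenever `Φ(G₁,…,Gₙ) ∈ ℕ` and `Fᵢ`, `Gᵢ` are equal
on `Xᵢ` for all `i`. -/
def CountablyBased {σ : Ty} (Φ : Par σ) : Prop :=
  ∀ F : Args σ, (∃ k, Φ.eval F = some k) →
    ∃ X : Supp σ, X.Countable ∧
      ∀ G : Args σ, (∃ k, Φ.eval G = some k) → X.Agree F G → Φ.eval F = Φ.eval G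

end PartialFun

/-!
Interpretations of terms are followed along a filter `l` of perturbed assignments: a partial
functional `φ` is *coherent* with a family `ψ w` if each value `φ a = k` is not contradicted by
`ψ w b` for `l`-almost all `w` and all `b` that agree with `a` on suitable countable sets. Every
term constructor preserves coherence. For application `t s` with `[[s]] = f` total, `[[t]]` looks at
countably many values of `f` only, and each of them persists for `l`-almost all `w`, so `l` has to
be closed under countable intersections. For `μ`, the restriction of the least fixed point to its
coherent values is a pre-fixed point, hence is the whole least fixed point. For `λ`, the bound
variable has rank at most two, so its arguments range over a countable set and countable agreement
of two such arguments means equality.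
-/

namespace PartialFun

open Filter

theorem Tot.ext_eval {σ : Ty} {f g : Tot σ} (h : ∀ a, f.eval a = g.eval a) : f = g :=
  Tot.toPar_injective <| Par.ext_eval fun a => by rw [Tot.eval_toPar, Tot.eval_toPar, h]

theorem Par.eval_app_eq_some_iff {σ τ : Ty} {φ : Par (.arr σ τ)} {ψ : Par σ} {a : Args τ} {k : ℕ} :
    (φ.app ψ).eval a = some k ↔ ∃ f : Tot σ, f.toPar = ψ ∧ (φ f).eval a = some k := by
  constructor
  · intro hk
    by_cases hψ : ∃ f : Tot σ, f.toPar = ψ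
    · obtain ⟨f, rfl⟩ := hψ
      exact ⟨f, rfl, by rwa [Par.app_toPar] at hk⟩
    · rw [Par.app_eq_bot φ hψ, Par.eval_bot] at hk
      cases hk
  · rintro ⟨f, rfl, hk⟩
    rwa [Par.app_toPar]

theorem caseVal_eq_some_iff {z x y : Option ℕ} {k : ℕ} :
    caseVal z x y = some k ↔
      (z = some 0 ∧ x = some k) ∨ ∃ m, z = some (m + 1) ∧ y = some k := by
  match z with
  | none => simp [caseVal]
  | some 0 => simp [caseVal]
  | some (m + 1) => simp [caseVal]

theorem Par.eval_lfp_induction {σ : Ty} {f : Par σ → Par σ} {P : Args σ → ℕ → Prop}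
    (hf : ∀ φ ψ, φ.Le ψ → (f φ).Le (f ψ))
    (hP : ∀ φ : Par σ, (∀ a k, φ.eval a = some k → P a k) →
      ∀ a k, (f φ).eval a = some k → P a k)
    (a : Args σ) (k : ℕ) (hk : (Par.lfp f).eval a = some k) : P a k := by
  classical
  let φ : Par σ := Par.ofEval fun a => ((Par.lfp f).eval a).filter (P a ·)
  have eval_φ {a k} : φ.eval a = some k ↔ (Par.lfp f).eval a = some k ∧ P a k := by
    simp only [φ, Par.eval_ofEval, Option.filter_eq_some_iff, decide_eq_true_eq]
  have φ_le : φ.Le (Par.lfp f) := fun _ _ h => (eval_φ.1 h).1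
  have f_φ_le : (f φ).Le φ := fun b m h => by
    have h' := hf _ _ φ_le b m h
    rw [(Par.lfp_spec f hf).1] at h'
    exact eval_φ.2 ⟨h', hP φ (fun _ _ h => (eval_φ.1 h).2) b m h⟩
  exact (eval_φ.1 (Par.lfp_le f hf f_φ_le a k hk)).2

/-- The countable neighbourhoods of `f`: the filter on `F(σ)` generated by the sets of functionals
that agree with `f` on a countable set of arguments. -/
def Tot.countableNhds {σ : Ty} (f : Tot σ) : Filter (Tot σ) :=
  countableGenerate (Set.range fun a => {g : Tot σ | f.eval a = g.eval a})

instance Tot.countableInterFilter_countableNhds {σ : Ty} (f : Tot σ) :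
    CountableInterFilter f.countableNhds :=
  inferInstanceAs (CountableInterFilter (countableGenerate _))

theorem Tot.eventually_eval_eq {σ : Ty} (f : Tot σ) (a : Args σ) :
    ∀ᶠ g in f.countableNhds, f.eval a = g.eval a :=
  CountableGenerateSets.basic ⟨a, rfl⟩

theorem Tot.hasBasis_countableNhds {σ : Ty} (f : Tot σ) :
    f.countableNhds.HasBasis Set.Countable
      fun X : Set (Args σ) => {g | ∀ a ∈ X, f.eval a = g.eval a} where
  mem_iff' S := by
    constructor
    · intro hS
      obtain ⟨𝒢, h𝒢, h𝒢c, hsub⟩ := mem_countableGenerate_iff.1 hS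
      choose a ha using h𝒢
      have := h𝒢c.to_subtype
      refine ⟨Set.range fun T : 𝒢 => a T.2, Set.countable_range _, fun g hg => hsub fun T hT => ?_⟩
      rw [← ha hT]
      exact hg _ ⟨⟨T, hT⟩, rfl⟩
    · rintro ⟨X, hX, hXS⟩
      exact mem_of_superset
        ((eventually_countable_ball hX).2 fun a _ => f.eventually_eval_eq a) hXS

theorem Tot.pure_le_countableNhds {σ : Ty} (f : Tot σ) : pure f ≤ f.countableNhds :=
  f.hasBasis_countableNhds.ge_iff.2 fun _ _ _ _ => rfl

/-- The product of the filters of countable neighbourhoods of the components of a tuple of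
arguments. -/
def Args.countableNhds : {σ : Ty} → Args σ → Filter (Args σ)
  | .nat, a => pure a
  | .arr _ _, a => Tot.countableNhds a.1 ×ˢ Args.countableNhds a.2

theorem Args.hasBasis_countableNhds : {σ : Ty} → (a : Args σ) →
    a.countableNhds.HasBasis Supp.Countable fun X : Supp σ => {b | X.Agree a b}
  | .nat, _ => ⟨fun _ => ⟨fun hS => ⟨(), trivial, fun _ _ => hS⟩, fun ⟨_, _, hS⟩ => hS trivial⟩⟩
  | .arr _ _, a => (Tot.hasBasis_countableNhds a.1).prod (Args.hasBasis_countableNhds a.2)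

theorem Args.pure_le_countableNhds : {σ : Ty} → (a : Args σ) → pure a ≤ a.countableNhds
  | .nat, _ => le_rfl
  | .arr _ _, a => prod_pure_pure.symm.trans_le <|
      prod_mono (Tot.pure_le_countableNhds a.1) (Args.pure_le_countableNhds a.2)

theorem Ty.rank_arr_le_succ_iff {σ τ : Ty} {n : ℕ} :
    (Ty.arr σ τ).rank ≤ n + 1 ↔ σ.rank ≤ n ∧ τ.rank ≤ n + 1 := by
  simp only [Ty.rank, max_le_iff, Nat.add_le_add_iff_right]

theorem Ty.eq_nat_of_rank_eq_zero : {σ : Ty} → σ.rank = 0 → σ = .nat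
  | .nat, _ => rfl
  | .arr _ _, h => by simp [Ty.rank] at h

theorem Args.countable_of_rank_le_one : {σ : Ty} → σ.rank ≤ 1 → Countable (Args σ)
  | .nat, _ => inferInstanceAs (Countable Unit)
  | .arr _ _, h => by
    obtain ⟨hσ, hτ⟩ := Ty.rank_arr_le_succ_iff.1 h
    obtain rfl := Ty.eq_nat_of_rank_eq_zero (Nat.le_zero.1 hσ)
    have := Args.countable_of_rank_le_one hτ
    exact inferInstanceAs (Countable (ℕ × Args _))

theorem Tot.countableNhds_eq_pure {σ : Ty} (hσ : σ.rank ≤ 1) (f : Tot σ) :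
    f.countableNhds = pure f := by
  have := Args.countable_of_rank_le_one hσ
  refine (le_pure_iff.2 ?_).antisymm f.pure_le_countableNhds
  filter_upwards [eventually_countable_forall.2 f.eventually_eval_eq] with g hg
  exact (Tot.ext_eval hg).symm

theorem Args.countableNhds_eq_pure : {σ : Ty} → σ.rank ≤ 2 → (a : Args σ) →
    a.countableNhds = pure a
  | .nat, _, _ => rfl
  | .arr _ _, h, a => by
    obtain ⟨hσ, hτ⟩ := Ty.rank_arr_le_succ_iff.1 h
    rw [Args.countableNhds, Tot.countableNhds_eq_pure hσ, Args.countableNhds_eq_pure hτ]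
    exact prod_pure_pure

theorem countablyBased_iff {σ : Ty} {φ : Par σ} :
    CountablyBased φ ↔ ∀ a k, φ.eval a = some k →
      ∀ᶠ b in a.countableNhds, ∀ k', φ.eval b = some k' → k' = k := by
  constructor
  · intro h a k hk
    obtain ⟨X, hX, hagree⟩ := h a ⟨k, hk⟩
    refine a.hasBasis_countableNhds.eventually_iff.2 ⟨X, hX, fun b hb k' hk' => ?_⟩
    rw [← Option.some_inj, ← hk', ← hk, hagree b ⟨k', hk'⟩ hb]
  · rintro h a ⟨k, hk⟩
    obtain ⟨X, hX, hagree⟩ := a.hasBasis_countableNhds.eventually_iff.1 (h a k hk)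
    refine ⟨X, hX, fun b ⟨k', hk'⟩ hb => ?_⟩
    rw [hk, hk', hagree hb k' hk']

theorem CountablyBased.of_le {σ : Ty} {φ ψ : Par σ} (h : φ.Le ψ) (hψ : CountablyBased ψ) :
    CountablyBased φ :=
  countablyBased_iff.2 fun a k hk =>
    (countablyBased_iff.1 hψ a k (h a k hk)).mono fun b hb k' hk' => hb k' (h b k' hk')

theorem CountablyBased.of_rank_le_two {σ : Ty} (hσ : σ.rank ≤ 2) (φ : Par σ) :
    CountablyBased φ :=
  countablyBased_iff.2 fun a k hk => by
    rw [Args.countableNhds_eq_pure hσ]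
    exact eventually_pure.2 fun k' hk' => Option.some.inj (hk'.symm.trans hk)

theorem CountablyBased.bot (σ : Ty) : CountablyBased (Par.bot σ) :=
  countablyBased_iff.2 fun a k hk => by
    rw [Par.eval_bot] at hk
    cases hk

/-- `φ` is coherent with the family `ψ` along `l`: if `φ a = k`, then `ψ w b` is undefined or `k`
for all `w` and `b` that are close to `l` and to `a`. The element `φ` itself need not belong to the
family. -/
def Par.Coherent {W : Type*} {σ : Ty} (φ : Par σ) (l : Filter W) (ψ : W → Par σ) : Prop :=
  ∀ (a : Args σ) (k : ℕ), φ.eval a = some k →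
    ∀ᶠ p in l ×ˢ a.countableNhds, ∀ k', (ψ p.1).eval p.2 = some k' → k' = k

/-- Coherence of the assignment `ρ` with the family `E` of assignments, at every variable. -/
def Env.Coherent {W : Type*} (ρ : Env) (l : Filter W) (E : W → Env) : Prop :=
  ∀ σ i, (ρ σ i).Coherent l fun w => E w σ i

section Coherent

variable {W : Type*} {l : Filter W} {σ τ : Ty}

theorem CountablyBased.coherent {φ : Par σ} (h : CountablyBased φ) : φ.Coherent l fun _ => φ :=
  fun a k hk => (countablyBased_iff.1 h a k hk).prod_inr l

theorem Par.Coherent.countablyBased [l.NeBot] {φ : Par σ} (h : φ.Coherent l fun _ => φ) :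
    CountablyBased φ :=
  countablyBased_iff.2 fun a k hk => eventually_const.1 (h a k hk).curry

theorem Par.Coherent.eventually_eval {φ : Par σ} {ψ : W → Par σ} (h : φ.Coherent l ψ) {a : Args σ}
    {k : ℕ} (hk : φ.eval a = some k) : ∀ᶠ w in l, ∀ k', (ψ w).eval a = some k' → k' = k :=
  (h a k hk).curry.mono fun _ hw => eventually_pure.1 (hw.filter_mono a.pure_le_countableNhds)

theorem Par.Coherent.of_rank_le_two (hσ : σ.rank ≤ 2) {φ : Par σ} {ψ : W → Par σ}
    (h : ∀ a k, φ.eval a = some k → ∀ᶠ w in l, ∀ k', (ψ w).eval a = some k' → k' = k) :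
    φ.Coherent l ψ := fun a k hk => by
  rw [Args.countableNhds_eq_pure hσ, prod_pure]
  exact h a k hk

theorem Par.Coherent.comp_tendsto {V : Type*} {m : Filter V} {u : V → W} {φ : Par σ}
    {ψ : W → Par σ} (h : φ.Coherent l ψ) (hu : Tendsto u m l) : φ.Coherent m fun v => ψ (u v) :=
  fun a k hk => (hu.prodMap tendsto_id).eventually (h a k hk)

theorem Tot.coherent_toPar (hσ : σ.rank ≤ 2) (f : Tot σ) :
    f.toPar.Coherent (l ×ˢ f.countableNhds) fun p => p.2.toPar :=
  .of_rank_le_two hσ fun a k hk => by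
    filter_upwards [(f.eventually_eval_eq a).prod_inr l] with p hp k' hk'
    rw [Tot.eval_toPar, Option.some_inj] at hk hk'
    rw [← hk, ← hk', hp]

theorem Par.Coherent.caseVal {z x y : Par .nat} {z' x' y' : W → Par .nat} (hz : z.Coherent l z')
    (hx : x.Coherent l x') (hy : y.Coherent l y') :
    Par.Coherent (σ := .nat) (PartialFun.caseVal z x y) l
      fun w => PartialFun.caseVal (z' w) (x' w) (y' w) := by
  refine .of_rank_le_two (σ := .nat) (by decide) fun a k hk => ?_
  rcases caseVal_eq_some_iff.1 hk with ⟨hz₀, hxk⟩ | ⟨m, hzm, hyk⟩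
  · filter_upwards [hz.eventually_eval (a := a) hz₀, hx.eventually_eval (a := a) hxk]
      with w hzw hxw k' hk'
    rcases caseVal_eq_some_iff.1 hk' with ⟨-, hk'⟩ | ⟨n, hn, -⟩
    · exact hxw k' hk'
    · cases hzw _ hn
  · filter_upwards [hz.eventually_eval (a := a) hzm, hy.eventually_eval (a := a) hyk]
      with w hzw hyw k' hk'
    rcases caseVal_eq_some_iff.1 hk' with ⟨h₀, -⟩ | ⟨n, -, hk'⟩
    · cases hzw _ h₀
    · exact hyw k' hk'

theorem Par.Coherent.lam {φ : Par (.arr σ τ)} {ψ : W → Par (.arr σ τ)}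
    (h : ∀ f : Tot σ, (φ f).Coherent (l ×ˢ f.countableNhds) fun p => ψ p.1 p.2) :
    φ.Coherent l ψ :=
  fun a k hk => tendsto_prodAssoc_symm.eventually (h a.1 a.2 k hk)

theorem Par.Coherent.eventually_mem_of_toPar [CountableInterFilter l] {f : Tot σ} {ψ : W → Par σ}
    (h : f.toPar.Coherent l ψ) {S : Set (Tot σ)} (hS : S ∈ f.countableNhds) :
    ∀ᶠ w in l, ∀ g : Tot σ, g.toPar = ψ w → g ∈ S := by
  obtain ⟨X, hX, hXS⟩ := f.hasBasis_countableNhds.mem_iff.1 hS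
  have hψ : ∀ᶠ w in l, ∀ a ∈ X, ∀ k, (ψ w).eval a = some k → k = f.eval a :=
    (eventually_countable_ball hX).2 fun a _ => h.eventually_eval (f.eval_toPar a)
  filter_upwards [hψ] with w hw g hg
  exact hXS fun a ha => (hw a ha _ (hg ▸ g.eval_toPar a)).symm

theorem Par.Coherent.app [CountableInterFilter l] {φ : Par (.arr σ τ)} {φ' : W → Par (.arr σ τ)}
    {ψ : Par σ} {ψ' : W → Par σ} (hφ : φ.Coherent l φ') (hψ : ψ.Coherent l ψ') :
    (φ.app ψ).Coherent l fun w => (φ' w).app (ψ' w) := by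
  intro a k hk
  obtain ⟨f, rfl, hfk⟩ := Par.eval_app_eq_some_iff.1 hk
  obtain ⟨p, hp, q, hq, hpq⟩ := eventually_prod_iff.1 (hφ (f, a) k hfk)
  obtain ⟨r, hr, s, hs, hrs⟩ := eventually_prod_iff.1 hq
  filter_upwards [(hp.and (hψ.eventually_mem_of_toPar hr)).prod_mk hs]
  rintro ⟨w, b⟩ ⟨⟨hw, hgr⟩, hb⟩ k' hk'
  obtain ⟨g, hg, hk'⟩ := Par.eval_app_eq_some_iff.1 hk'
  exact hpq hw (hrs (hgr g hg) hb) k' hk'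

theorem Par.Coherent.lfp {f : Par σ → Par σ} {χ : W → Par σ}
    (hf : ∀ φ ψ, φ.Le ψ → (f φ).Le (f ψ))
    (h : ∀ φ : Par σ, φ.Coherent l χ → (f φ).Coherent l χ) : (Par.lfp f).Coherent l χ :=
  Par.eval_lfp_induction hf h

theorem Env.Coherent.set {ρ : Env} {E : W → Env} (h : ρ.Coherent l E) (i : ℕ) {φ : Par σ}
    {ψ : W → Par σ} (hφ : φ.Coherent l ψ) :
    (ρ.set i σ φ).Coherent l fun w => (E w).set i σ (ψ w) := by
  intro τ j
  unfold Env.set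
  by_cases e : σ = τ ∧ i = j
  · obtain ⟨rfl, rfl⟩ := e
    simpa using hφ
  · simpa [e] using h τ j

end Coherent

theorem Term.interp_set_mono {σ τ : Ty} (t : Term τ) (ρ : Env) (i : ℕ) (φ ψ : Par σ)
    (h : φ.Le ψ) : (t.interp (ρ.set i σ φ)).Le (t.interp (ρ.set i σ ψ)) :=
  t.interp_mono (Env.set_mono (fun _ _ => Par.Le.refl _) i σ h)

theorem Term.coherent_interp {σ : Ty} {t : Term σ} (ht : t.NoConst) {W : Type*} {l : Filter W}
    [CountableInterFilter l] {ρ : Env} {E : W → Env} (h : ρ.Coherent l E) :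
    (t.interp ρ).Coherent l fun w => t.interp (E w) := by
  induction t generalizing W ρ with
  | zero | suc | pred | case => exact (CountablyBased.of_rank_le_two (by decide) _).coherent
  | caseOf t₁ t₂ t₃ ih₁ ih₂ ih₃ => exact (ih₁ ht.1 h).caseVal (ih₂ ht.2.1 h) (ih₃ ht.2.2 h)
  | var i σ => exact h σ i
  | const => exact ht.elim
  | app t s iht ihs => exact (iht ht.1 h).app (ihs ht.2 h)
  | lam i σ hr t ih =>
    refine .lam fun f => ?_
    have hσ : σ.rank ≤ 2 := (Ty.rank_arr_le_succ_iff.1 hr).1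
    have : CountableInterFilter (l ×ˢ f.countableNhds) := by
      rw [prod_eq_inf]
      infer_instance
    have h' : ρ.Coherent (l ×ˢ f.countableNhds) fun p => E p.1 :=
      fun τ j => (h τ j).comp_tendsto tendsto_fst
    exact ih ht (h'.set i (f.coherent_toPar hσ))
  | mu i σ hσ t ih =>
    refine .lfp (t.interp_set_mono ρ i) fun φ hφ => ?_
    have hstep := ih ht (h.set i hφ)
    simp only [(Term.interp_mu i hσ t _).1] at hstep
    exact hstep

theorem Term.countablyBased_interp {σ : Ty} {t : Term σ} (ht : t.NoConst) {ρ : Env}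
    (hρ : ∀ τ i, CountablyBased (ρ τ i)) : CountablyBased (t.interp ρ) :=
  (Term.coherent_interp (l := (⊤ : Filter Unit)) ht fun τ i => (hρ τ i).coherent).countablyBased

/-- The assignment `ρ` with its values changed according to the replacement `θ`. -/
def Env.override (ρ : Env) (θ : Repl) : Env :=
  fun σ i => (θ σ i).getD (ρ σ i)

theorem Env.override_erase_set (ρ : Env) (θ : Repl) (i : ℕ) (σ : Ty) (φ : Par σ) :
    (ρ.set i σ φ).override (θ.erase i σ) = (ρ.override θ).set i σ φ := by
  funext τ j
  unfold Env.override Env.set Repl.erase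
  split_ifs <;> rfl

theorem Term.interp_subst {σ : Ty} (t : Term σ) (θ : Repl) (ρ : Env) :
    (t.subst θ).interp ρ = t.interp (ρ.override θ) := by
  induction t generalizing θ ρ with
  | zero | suc | pred | case | const => rfl
  | caseOf t₁ t₂ t₃ ih₁ ih₂ ih₃ => rw [Term.subst, Term.interp, ih₁, ih₂, ih₃, Term.interp]
  | var i σ =>
    simp only [Term.subst, Term.interp, Env.override]
    cases θ σ i <;> rfl
  | app t s iht ihs => simp only [Term.subst, Term.interp, iht, ihs]
  | lam i σ _ t ih =>
    exact funext fun f => (ih _ _).trans (congrArg t.interp (ρ.override_erase_set θ i σ f.toPar))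
  | mu i σ _ t ih =>
    exact congrArg Par.lfp (funext fun ψ => by rw [ih, Env.override_erase_set])

theorem Repl.ofList_eq_some {n : ℕ} {σ : Fin n → Ty} {v : Fin n → ℕ}
    {φ : (i : Fin n) → Par (σ i)} {τ : Ty} {j : ℕ} {ψ : Par τ}
    (h : Repl.ofList σ v φ τ j = some ψ) : ∃ i, σ i = τ ∧ φ i ≍ ψ := by
  unfold Repl.ofList at h
  split_ifs at h with e
  obtain rfl := Option.some.inj h
  exact ⟨e.choose, e.choose_spec.1, (eqRec_heq _ _).symm⟩

theorem Repl.countablyBased_of_ofList_eq_some {n : ℕ} {σ : Fin n → Ty} {v : Fin n → ℕ}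
    {φ : (i : Fin n) → Par (σ i)} (h : ∀ i, CountablyBased (φ i)) {τ : Ty} {j : ℕ} {ψ : Par τ}
    (hψ : Repl.ofList σ v φ τ j = some ψ) : CountablyBased ψ := by
  obtain ⟨i, rfl, hi⟩ := Repl.ofList_eq_some hψ
  exact eq_of_heq hi ▸ h i

theorem Env.countablyBased_override {ρ : Env} {θ : Repl} (hρ : ∀ σ i, CountablyBased (ρ σ i))
    (hθ : ∀ σ i φ, θ σ i = some φ → CountablyBased φ) (σ : Ty) (i : ℕ) :
    CountablyBased (ρ.override θ σ i) := by
  unfold Env.override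
  cases h : θ σ i with
  | none => exact hρ σ i
  | some φ => exact hθ σ i φ h

end PartialFun

theorem mainTheorem11 {τ : PartialFun.Ty} (hτ : τ.rank ≤ 3) (Φ : PartialFun.Par τ)
    {n : ℕ} (σ : Fin n → PartialFun.Ty) (hσ : ∀ i, (σ i).rank ≤ 3)
    (φ : (i : Fin n) → PartialFun.Par (σ i))
    (hcomp : PartialFun.Computable Φ σ φ)
    (hcb : ∀ i, PartialFun.CountablyBased (φ i)) :
    PartialFun.CountablyBased Φ := by
  obtain ⟨s, v, -, hs, -, hle⟩ := hcomp
  rw [s.interp_subst] at hle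
  refine .of_le hle (PartialFun.Term.countablyBased_interp hs ?_)
  exact PartialFun.Env.countablyBased_override (fun _ _ => .bot _)
    fun _ _ _ => PartialFun.Repl.countablyBased_of_ofList_eq_some hcb
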